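/- Let $X=[0,1)$ and $X'=(0,1]$ be two disjoint copies of the indicated intervals, and let $\tilde X=X\sqcup X'$ be Alexandroff's ``two arrows'' space, with the topology whose base consists of all sets $$[\alpha,\beta)\cup(\alpha',\beta')\quad\text{and}\quad(\alpha,\beta)\cup(\alpha',\beta'],\qquad 0\le\alpha<\beta\le1,$$ where the first interval lies in $X$, the second one lies in $X'$, and both have the same endpoints $\alpha,\beta$. This space is compact. The commutative $C^*$-algebra $A=C(\tilde X)$ of continuous complex-valued functions on $\tilde X$, with the supremum norm, has the following properties. 1. $A$ is not separable. 2. $A$ is hereditarily projective: every closed left ideal of $A$ is projective in the category of left Banach $A$-modules. 3. $A$ is contained in $\mathcal B(H)$ for some separable complex Hilbert space $H$: there is an isometric unital $*$-homomorphism $A\to\mathcal B(H)$. In particular, there exists a nonseparable, hereditarily projective, commutative $C^*$-algebra contained in $\mathcal B(H)$ for a separable Hilbert space $H$. Here a left Banach $A$-module is a complex Banach space $Y$ with a bounded bilinear map $A\times Y\to Y$, $(a,y)\mapsto a\cdot y$, such that $(ab)\cdot y=a\cdot(b\cdot y)$; morphisms are the bounded linear maps that commute with the actions. A left Banach $A$-module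 $P$ is projective if, for each left Banach $A$-module $Y$ and each epimorphism of modules $\varphi:Y\to P$ that has a right inverse among the bounded linear maps, there is a morphism of modules $\psi:P\to Y$ with $\varphi\circ\psi=\mathrm{id}_P$. -/

import Mathlib

universe u v w

/-! ### Banach modules and projectivity -/

section BanachModules

/-- A left Banach module structure over a (not necessarily unital) complex normed algebra `A` on a
normed space `Y` (whose completeness is required separately): a jointly bounded bilinear
associative action. Even if `A` has an identity, it is not required to act as the identity. -/
structure LeftBanachModule (A : Type u) [NonUnitalNormedRing A] [NormedSpace ℂ A]
    (Y : Type v) [NormedAddCommGroup Y] [NormedSpace ℂ Y] where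
  /-- the action `a ↦ (y ↦ a · y)` -/
  act : A →L[ℂ] Y →L[ℂ] Y
  mul_act : ∀ (a b : A) (y : Y), act (a * b) y = act a (act b y)

/-- A bounded linear map is a morphism of left Banach `A`-modules if it commutes with the
actions. -/
def IsModuleMorphism {A : Type u} [NonUnitalNormedRing A] [NormedSpace ℂ A]
    {Y : Type v} [NormedAddCommGroup Y] [NormedSpace ℂ Y]
    {Z : Type w} [NormedAddCommGroup Z] [NormedSpace ℂ Z]
    (mY : LeftBanachModule A Y) (mZ : LeftBanachModule A Z) (f : Y →L[ℂ] Z) : Prop :=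
  ∀ (a : A) (y : Y), f (mY.act a y) = mZ.act a (f y)

/-- A left Banach `A`-module `P` is projective if every epimorphism of left Banach modules
`φ : Y → P` that has a right inverse `σ` among the bounded linear maps also has a right inverse
`ψ` among the module morphisms. (A `φ` with such a `σ` is surjective, hence an epimorphism.) -/
def LeftBanachModule.IsProjective {A : Type u} [NonUnitalNormedRing A] [NormedSpace ℂ A]
    {P : Type v} [NormedAddCommGroup P] [NormedSpace ℂ P] (mP : LeftBanachModule A P) : Prop :=
  ∀ (Y : Type w) [NormedAddCommGroup Y] [NormedSpace ℂ Y] [CompleteSpace Y]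
    (mY : LeftBanachModule A Y) (φ : Y →L[ℂ] P), IsModuleMorphism mY mP φ →
    (∃ σ : P →L[ℂ] Y, φ.comp σ = ContinuousLinearMap.id ℂ P) →
    ∃ ψ : P →L[ℂ] Y, IsModuleMorphism mP mY ψ ∧ φ.comp ψ = ContinuousLinearMap.id ℂ P

/-- The linear subspace `I` is a left ideal of the algebra `A`. -/
def IsLeftIdeal {A : Type u} [NonUnitalNormedRing A] [NormedSpace ℂ A]
    (I : Submodule ℂ A) : Prop :=
  ∀ a : A, ∀ x ∈ I, a * x ∈ I

/-- A left ideal of `A` as a left `A`-module, with the multiplication of `A` as the action. -/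
noncomputable def LeftBanachModule.ofLeftIdeal {A : Type u} [NonUnitalNormedRing A]
    [NormedSpace ℂ A] [IsScalarTower ℂ A A] [SMulCommClass ℂ A A]
    (I : Submodule ℂ A) (hI : IsLeftIdeal I) : LeftBanachModule A I where
  act := LinearMap.mkContinuous₂
    (LinearMap.mk₂ ℂ (fun (a : A) (x : I) => (⟨a * (x : A), hI a x x.2⟩ : I))
      (fun a b x => Subtype.ext (add_mul a b (x : A)))
      (fun c a x => Subtype.ext (smul_mul_assoc c a (x : A)))
      (fun a x y => Subtype.ext (mul_add a (x : A) (y : A)))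
      (fun c a x => Subtype.ext (mul_smul_comm c a (x : A))))
    1 (fun a x => by simpa using norm_mul_le a (x : A))
  mul_act a b x := Subtype.ext (mul_assoc a b (x : A))

/-- A Banach algebra is hereditarily projective if all its closed left ideals are projective left
Banach modules. -/
def IsHereditarilyProjective (A : Type u) [NonUnitalNormedRing A] [NormedSpace ℂ A]
    [IsScalarTower ℂ A A] [SMulCommClass ℂ A A] : Prop :=
  ∀ (I : Submodule ℂ A) (hI : IsLeftIdeal I), IsClosed (I : Set A) →
    LeftBanachModule.IsProjective.{u, u, w} (LeftBanachModule.ofLeftIdeal I hI)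

end BanachModules

/-! ### The two arrows space -/

/-- The underlying set of the two arrows space: the disjoint union of the lower interval
`X = [0, 1)` and the upper interval `X' = (0, 1]`. -/
inductive TwoArrows : Type
  | lower (x : Set.Ico (0 : ℝ) 1)
  | upper (x : Set.Ioc (0 : ℝ) 1)

namespace TwoArrows

/-- The set `[α, β) ∪ (α', β')`, with `[α, β)` in the lower and `(α', β')` in the upper
interval. -/
def lowerArrow (α β : ℝ) : Set TwoArrows :=
  lower '' {x | x.1 ∈ Set.Ico α β} ∪ upper '' {x | x.1 ∈ Set.Ioo α β}

/-- The set `(α, β) ∪ (α', β']`, with `(α, β)` in the lower and `(α', β']` in the upper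
interval. -/
def upperArrow (α β : ℝ) : Set TwoArrows :=
  lower '' {x | x.1 ∈ Set.Ioo α β} ∪ upper '' {x | x.1 ∈ Set.Ioc α β}

theorem lower_mem_lowerArrow {α β : ℝ} {x : Set.Ico (0 : ℝ) 1} :
    lower x ∈ lowerArrow α β ↔ α ≤ x.1 ∧ x.1 < β := by
  simp [lowerArrow]

theorem upper_mem_lowerArrow {α β : ℝ} {x : Set.Ioc (0 : ℝ) 1} :
    upper x ∈ lowerArrow α β ↔ α < x.1 ∧ x.1 < β := by
  simp [lowerArrow]

theorem lower_mem_upperArrow {α β : ℝ} {x : Set.Ico (0 : ℝ) 1} :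
    lower x ∈ upperArrow α β ↔ α < x.1 ∧ x.1 < β := by
  simp [upperArrow]

theorem upper_mem_upperArrow {α β : ℝ} {x : Set.Ioc (0 : ℝ) 1} :
    upper x ∈ upperArrow α β ↔ α < x.1 ∧ x.1 ≤ β := by
  simp [upperArrow]

/-- The base of the topology: all `lowerArrow α β` with `[α, β) ⊆ [0, 1)` and all
`upperArrow α β` with `(α, β] ⊆ (0, 1]`. -/
def base : Set (Set TwoArrows) :=
  {s | ∃ α β : ℝ, 0 ≤ α ∧ α < β ∧ β ≤ 1 ∧ (s = lowerArrow α β ∨ s = upperArrow α β)}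

instance : TopologicalSpace TwoArrows := TopologicalSpace.generateFrom base

/-- The family `base` is a base of the topology that it generates. -/
theorem isTopologicalBasis_base : TopologicalSpace.IsTopologicalBasis base := by
  refine ⟨?_, ?_, rfl⟩
  · rintro s ⟨a, b, ha, hab, hb, hs⟩ t ⟨c, d, hc, hcd, hd, ht⟩ p ⟨hp, hq⟩
    rcases p with ⟨x, hx0, hx1⟩ | ⟨x, hx0, hx1⟩
    · have hx : a ≤ x ∧ x < b ∧ c ≤ x ∧ x < d := by
        rcases hs with rfl | rfl <;> rcases ht with rfl | rfl <;>
          simp only [lower_mem_lowerArrow, upper_mem_lowerArrow,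
            lower_mem_upperArrow, upper_mem_upperArrow] at hp hq <;> grind
      refine ⟨lowerArrow x (min b d), ⟨x, min b d, hx0, lt_min hx.2.1 hx.2.2.2,
        (min_le_left _ _).trans hb, Or.inl rfl⟩, ?_, ?_⟩
      · simp [lower_mem_lowerArrow, hx.2.1, hx.2.2.2]
      · rintro (⟨y, hy0, hy1⟩ | ⟨y, hy0, hy1⟩) hy <;>
          rcases hs with rfl | rfl <;> rcases ht with rfl | rfl <;>
          simp only [lower_mem_lowerArrow, upper_mem_lowerArrow,
            lower_mem_upperArrow, upper_mem_upperArrow, Set.mem_inter_iff, lt_min_iff] at hp hq hy ⊢ <;>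
          grind
    · have hx : a < x ∧ x ≤ b ∧ c < x ∧ x ≤ d := by
        rcases hs with rfl | rfl <;> rcases ht with rfl | rfl <;>
          simp only [lower_mem_lowerArrow, upper_mem_lowerArrow,
            lower_mem_upperArrow, upper_mem_upperArrow] at hp hq <;> grind
      refine ⟨upperArrow (max a c) x, ⟨max a c, x, ha.trans (le_max_left _ _),
        max_lt hx.1 hx.2.2.1, hx1, Or.inr rfl⟩, ?_, ?_⟩
      · simp [upper_mem_upperArrow, hx.1, hx.2.2.1]
      · rintro (⟨y, hy0, hy1⟩ | ⟨y, hy0, hy1⟩) hy <;>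
          rcases hs with rfl | rfl <;> rcases ht with rfl | rfl <;>
          simp only [lower_mem_lowerArrow, upper_mem_lowerArrow,
            lower_mem_upperArrow, upper_mem_upperArrow, Set.mem_inter_iff, max_lt_iff] at hp hq hy ⊢ <;>
          grind
  · refine Set.eq_univ_of_forall fun p => ?_
    rcases p with ⟨x, hx0, hx1⟩ | ⟨x, hx0, hx1⟩
    · exact ⟨lowerArrow 0 1, ⟨0, 1, le_rfl, one_pos, le_rfl, Or.inl rfl⟩,
        lower_mem_lowerArrow.2 ⟨hx0, hx1⟩⟩
    · exact ⟨upperArrow 0 1, ⟨0, 1, le_rfl, one_pos, le_rfl, Or.inr rfl⟩,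
        upper_mem_upperArrow.2 ⟨hx0, hx1⟩⟩

/-- The two arrows space is compact, so that `C(TwoArrows, ℂ)` with the supremum norm is a
C*-algebra. -/
instance : CompactSpace TwoArrows := by
  refine ⟨isCompact_generateFrom rfl fun P hP hcov => ?_⟩
  let seg : ℝ → Set TwoArrows :=
    fun t => lower '' {x | x.1 < t} ∪ upper '' {x | x.1 ≤ t}
  have hl : ∀ t x, lower x ∈ seg t ↔ x.1 < t := fun t x => by simp [seg]
  have hu : ∀ t x, upper x ∈ seg t ↔ x.1 ≤ t := fun t x => by simp [seg]
  let T : Set ℝ := {t | t ∈ Set.Icc (0 : ℝ) 1 ∧ ∃ Q ⊆ P, Q.Finite ∧ seg t ⊆ ⋃₀ Q}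
  have h0 : (0 : ℝ) ∈ T := by
    refine ⟨⟨le_rfl, zero_le_one⟩, ∅, Set.empty_subset _, Set.finite_empty, ?_⟩
    rintro (⟨y, hy0, hy1⟩ | ⟨y, hy0, hy1⟩) hy <;>
      simp only [hl, hu] at hy <;> linarith
  have hbdd : BddAbove T := ⟨1, fun t ht => ht.1.2⟩
  have hc0 : 0 ≤ sSup T := le_csSup hbdd h0
  have hc1 : sSup T ≤ 1 := csSup_le ⟨0, h0⟩ fun t ht => ht.1.2
  have hcT : sSup T ∈ T := by
    rcases hc0.eq_or_lt with h | hpos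
    · rw [← h]; exact h0
    obtain ⟨s, hsP, hs⟩ := hcov (Set.mem_univ (upper ⟨sSup T, hpos, hc1⟩))
    obtain ⟨a, ha, hsub⟩ : ∃ a < sSup T, ∀ p ∈ seg (sSup T), p ∉ seg a → p ∈ s := by
      obtain ⟨a, b, ha, hab, hb, rfl | rfl⟩ := hP hsP <;>
      · simp only [upper_mem_lowerArrow, upper_mem_upperArrow] at hs
        refine ⟨(a + sSup T) / 2, by linarith, ?_⟩
        rintro (⟨y, hy0, hy1⟩ | ⟨y, hy0, hy1⟩) hy hy' <;>
          simp only [hl, hu, lower_mem_lowerArrow, upper_mem_lowerArrow,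
            lower_mem_upperArrow, upper_mem_upperArrow] at hy hy' ⊢ <;> grind
    obtain ⟨t, ⟨-, Q, hQP, hQ, hQs⟩, hat⟩ := exists_lt_of_lt_csSup ⟨0, h0⟩ ha
    refine ⟨⟨hc0, hc1⟩, insert s Q, Set.insert_subset hsP hQP, hQ.insert s, fun p hp => ?_⟩
    by_cases hpt : p ∈ seg t
    · obtain ⟨q, hq, hpq⟩ := hQs hpt
      exact ⟨q, Set.mem_insert_of_mem _ hq, hpq⟩
    · refine ⟨s, Set.mem_insert _ _, hsub p hp fun hpa => hpt ?_⟩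
      rcases p with y | y
      · exact (hl _ _).2 (((hl _ _).1 hpa).trans hat)
      · exact (hu _ _).2 (((hu _ _).1 hpa).trans hat.le)
  have hc : sSup T = 1 := by
    by_contra hne
    have hlt : sSup T < 1 := lt_of_le_of_ne hc1 hne
    obtain ⟨s, hsP, hs⟩ := hcov (Set.mem_univ (lower ⟨sSup T, hc0, hlt⟩))
    obtain ⟨t, hct, ht1, hsub⟩ :
        ∃ t > sSup T, t ≤ 1 ∧ ∀ p ∈ seg t, p ∉ seg (sSup T) → p ∈ s := by
      obtain ⟨a, b, ha, hab, hb, rfl | rfl⟩ := hP hsP <;>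
      · simp only [lower_mem_lowerArrow, lower_mem_upperArrow] at hs
        refine ⟨(sSup T + b) / 2, by linarith, by linarith, ?_⟩
        rintro (⟨y, hy0, hy1⟩ | ⟨y, hy0, hy1⟩) hy hy' <;>
          simp only [hl, hu, lower_mem_lowerArrow, upper_mem_lowerArrow,
            lower_mem_upperArrow, upper_mem_upperArrow] at hy hy' ⊢ <;> grind
    obtain ⟨-, Q, hQP, hQ, hQs⟩ := hcT
    refine absurd (le_csSup hbdd (show t ∈ T from ⟨⟨hc0.trans hct.le, ht1⟩, insert s Q,
      Set.insert_subset hsP hQP, hQ.insert s, fun p hp => ?_⟩)) (not_le.2 hct)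
    by_cases hpt : p ∈ seg (sSup T)
    · obtain ⟨q, hq, hpq⟩ := hQs hpt
      exact ⟨q, Set.mem_insert_of_mem _ hq, hpq⟩
    · exact ⟨s, Set.mem_insert _ _, hsub p hp hpt⟩
  rw [hc] at hcT
  obtain ⟨-, Q, hQP, hQ, hQs⟩ := hcT
  refine ⟨Q, hQP, hQ, fun p _ => hQs ?_⟩
  rcases p with y | y
  · exact (hl _ _).2 y.2.2
  · exact (hu _ _).2 y.2.2

end TwoArrows

/-!
Characteristic functions of distinct clopen sets are at distance at least `1`, so a separable
`C(X)` leaves room for only countably many clopen sets, whereas the two arrows space has a clopen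
initial segment for each `t ∈ [0, 1)`. On the other hand the two arrows space is separable, and
evaluation along a dense family of points represents `C(X)` faithfully by diagonal operators
on `ℓ²`.

For hereditary projectivity, every open subset of the two arrows space is a countable union of
clopen sets `[α, β) ∪ (α', β']` with `α` or `β` rational, so the space is hereditarily Lindelöf.
As it is also compact and totally disconnected, its open subsets are countable disjoint unions of
clopen sets. A closed ideal of `C(X)` therefore consists of the functions vanishing off such a
union, and the characteristic functions `eᵢ` of the pieces are orthogonal idempotents with
`f = ∑ i, f * eᵢ` for `f` in the ideal. Given a bounded linear right inverse `σ` of a module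
epimorphism, the module morphism `ψ f = ∑ i, (f * eᵢ) • σ eᵢ` is again a right inverse. The series
converges because averaging over signs `ε` gives
`∑ i, (f * eᵢ) • σ eᵢ = 𝔼 ε, (f * ∑ i, εᵢ eᵢ) • σ (∑ i, εᵢ eᵢ)` for finite sums, and
`‖∑ i, εᵢ eᵢ‖ ≤ 1`.
-/

open Filter Topology TopologicalSpace

/-! ### Averaging over signs -/

section Signs

variable {ι : Type*} [Fintype ι]

theorem sum_sign_mul_sign [DecidableEq ι] (i j : ι) :
    ∑ ε : ι → ℤˣ, ((ε i * ε j : ℤˣ) : ℤ) = if i = j then 2 ^ Fintype.card ι else 0 := by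
  split_ifs with hij
  · simp [hij, Int.units_mul_self]
  · -- Flipping the sign at `i` changes the sign of every term.
    refine self_eq_neg.1 ?_
    rw [← Finset.sum_neg_distrib,
      ← Equiv.sum_comp (Equiv.mulLeft (Pi.mulSingle i (-1 : ℤˣ) : ι → ℤˣ))]
    simp [Ne.symm hij]

theorem sum_sign_bilinear [DecidableEq ι] {R E F G : Type*} [CommSemiring R] [AddCommGroup E]
    [Module R E] [AddCommGroup F] [Module R F] [AddCommGroup G] [Module R G]
    (B : E →ₗ[R] F →ₗ[R] G) (a : ι → E) (b : ι → F) :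
    ∑ ε : ι → ℤˣ, B (∑ i, ε i • a i) (∑ j, ε j • b j) =
      2 ^ Fintype.card ι • ∑ i, B (a i) (b i) := by
  calc ∑ ε : ι → ℤˣ, B (∑ i, ε i • a i) (∑ j, ε j • b j)
      = ∑ ε : ι → ℤˣ, ∑ j, ∑ i, ((ε j * ε i : ℤˣ) : ℤ) • B (a i) (b j) := by
        simp only [Units.smul_def, map_sum, map_zsmul, LinearMap.sum_apply, LinearMap.smul_apply,
          Finset.smul_sum, smul_smul, Units.val_mul]
    _ = ∑ j, ∑ i, (∑ ε : ι → ℤˣ, ((ε j * ε i : ℤˣ) : ℤ)) • B (a i) (b j) := by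
        simp only [Finset.sum_smul]
        rw [Finset.sum_comm]
        exact Finset.sum_congr rfl fun j _ => Finset.sum_comm
    _ = 2 ^ Fintype.card ι • ∑ i, B (a i) (b i) := by
        simp only [sum_sign_mul_sign, ite_smul, zero_smul, Finset.sum_ite_eq, Finset.mem_univ,
          if_true, Finset.smul_sum]
        norm_cast

theorem norm_sum_bilinear_le_of_forall_sign {R E F G : Type*} [CommSemiring R] [AddCommGroup E]
    [Module R E] [AddCommGroup F] [Module R F] [NormedAddCommGroup G] [NormedSpace ℝ G]
    [Module R G] (B : E →ₗ[R] F →ₗ[R] G) (a : ι → E) (b : ι → F) {C : ℝ}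
    (h : ∀ ε : ι → ℤˣ, ‖B (∑ i, ε i • a i) (∑ i, ε i • b i)‖ ≤ C) :
    ‖∑ i, B (a i) (b i)‖ ≤ C := by
  classical
  have hsum := norm_sum_le_of_le Finset.univ fun ε _ => h ε
  rw [sum_sign_bilinear, RCLike.norm_nsmul ℝ] at hsum
  simpa using hsum

end Signs

/-! ### Ideals generated by orthogonal idempotents -/

theorem exists_clm_hasSum_of_norm_sum_le {𝕜 ι E F : Type*} [NontriviallyNormedField 𝕜]
    [SeminormedAddCommGroup E] [NormedSpace 𝕜 E] [NormedAddCommGroup F] [NormedSpace 𝕜 F]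
    (T : ι → E →L[𝕜] F) (K : ℝ) (hT : ∀ x, Summable fun i => T i x)
    (hK : ∀ (t : Finset ι) x, ‖∑ i ∈ t, T i x‖ ≤ K * ‖x‖) :
    ∃ S : E →L[𝕜] F, ∀ x, HasSum (fun i => T i x) (S x) := by
  let S : E →ₗ[𝕜] F :=
    { toFun := fun x => ∑' i, T i x
      map_add' := fun x y => by simp only [map_add, (hT x).tsum_add (hT y)]
      map_smul' := fun c x => by simp only [map_smul, (hT x).tsum_const_smul c, RingHom.id_apply] }
  exact ⟨S.mkContinuous K fun x =>
    le_of_tendsto (hT x).hasSum.norm (Eventually.of_forall fun t => hK t x),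
    fun x => (hT x).hasSum⟩

section ApproxUnit

variable {A : Type u} [NonUnitalNormedRing A] [NormedSpace ℂ A] {ι : Type*}

/-- An unconditionally bounded approximate unit of the left ideal `I`, made of orthogonal
idempotents `e i`: every `f ∈ I` is the unconditional sum of the products `f * e i`, and the
finite sums of the `e i` with arbitrary signs are uniformly bounded. -/
structure IsOrthogonalApproxUnit (I : Submodule ℂ A) (e : ι → I) : Prop where
  isIdempotentElem : ∀ i, IsIdempotentElem (e i : A)
  mul_eq_zero : Pairwise fun i j => (e i : A) * e j = 0
  exists_norm_le : ∃ M : ℝ, ∀ (t : Finset ι) (ε : t → ℤˣ), ‖∑ i : t, ε i • e i‖ ≤ M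
  hasSum_mul : ∀ f ∈ I, HasSum (fun i => f * e i) f

namespace IsOrthogonalApproxUnit

variable {I : Submodule ℂ A} {e : ι → I}

theorem sub_sum_mul_mul (he : IsOrthogonalApproxUnit I e) (f : A) {t : Finset ι} {i : ι}
    (hi : i ∉ t) : (f - ∑ j ∈ t, f * e j) * e i = f * e i := by
  rw [sub_mul, Finset.sum_mul, Finset.sum_eq_zero, sub_zero]
  intro j hj
  rw [mul_assoc, he.mul_eq_zero (ne_of_mem_of_not_mem hj hi), mul_zero]

variable {Y : Type*} [NormedAddCommGroup Y] [NormedSpace ℂ Y]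

theorem exists_norm_sum_act_le (he : IsOrthogonalApproxUnit I e) (mY : LeftBanachModule A Y)
    (σ : I →L[ℂ] Y) :
    ∃ K : ℝ, ∀ (t : Finset ι) (f : A), ‖∑ i ∈ t, mY.act (f * e i) (σ (e i))‖ ≤ K * ‖f‖ := by
  classical
  obtain ⟨M, hM⟩ := he.exists_norm_le
  refine ⟨‖mY.act‖ * M * (‖σ‖ * M), fun t f => ?_⟩
  rw [← Finset.sum_coe_sort t fun i => mY.act (f * e i) (σ (e i))]
  refine norm_sum_bilinear_le_of_forall_sign mY.act.toLinearMap₁₂ (fun i : t => f * (e i : A))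
    (fun i : t => σ (e i)) fun ε => ?_
  set s : I := ∑ i : t, ε i • e i with hs
  have hfs : ∑ i : t, ε i • (f * (e i : A)) = f * s := by
    simp [hs, Finset.mul_sum, Units.smul_def, mul_smul_comm]
  have hσs : ∑ i : t, ε i • σ (e i) = σ s := by
    simp [hs, Units.smul_def]
  have hM₀ : 0 ≤ M := (norm_nonneg s).trans (hM t ε)
  rw [hfs, hσs, ContinuousLinearMap.toLinearMap₁₂_apply_apply_apply]
  calc ‖mY.act (f * s) (σ s)‖ ≤ ‖mY.act‖ * ‖f * s‖ * ‖σ s‖ := mY.act.le_opNorm₂ _ _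
    _ ≤ ‖mY.act‖ * (‖f‖ * M) * (‖σ‖ * M) := by
        gcongr
        · exact norm_mul_le_of_le le_rfl (hM t ε)
        · exact σ.le_opNorm_of_le (hM t ε)
    _ = ‖mY.act‖ * M * (‖σ‖ * M) * ‖f‖ := by ring

theorem summable_act [CompleteSpace Y] (he : IsOrthogonalApproxUnit I e)
    (mY : LeftBanachModule A Y) (σ : I →L[ℂ] Y) {f : A} (hf : f ∈ I) :
    Summable fun i => mY.act (f * e i) (σ (e i)) := by
  obtain ⟨K, hK⟩ := he.exists_norm_sum_act_le mY σ
  refine summable_iff_vanishing_norm.2 fun δ hδ => ?_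
  have hrem : Tendsto (fun t : Finset ι => K * ‖f - ∑ j ∈ t, f * e j‖) atTop (𝓝 0) := by
    simpa using ((he.hasSum_mul f hf).const_sub f).norm.const_mul K
  obtain ⟨t, ht⟩ := (hrem.eventually_lt_const hδ).exists
  refine ⟨t, fun s hs => ?_⟩
  calc ‖∑ i ∈ s, mY.act (f * e i) (σ (e i))‖
      = ‖∑ i ∈ s, mY.act ((f - ∑ j ∈ t, f * e j) * e i) (σ (e i))‖ := by
        refine congrArg norm (Finset.sum_congr rfl fun i hi => ?_)
        rw [he.sub_sum_mul_mul f (Finset.disjoint_left.1 hs hi)]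
    _ ≤ K * ‖f - ∑ j ∈ t, f * e j‖ := hK s _
    _ < δ := ht

theorem isProjective_ofLeftIdeal [IsScalarTower ℂ A A] [SMulCommClass ℂ A A]
    (he : IsOrthogonalApproxUnit I e) (hI : IsLeftIdeal I) :
    LeftBanachModule.IsProjective.{u, u, w} (LeftBanachModule.ofLeftIdeal I hI) := by
  intro Y _ _ _ mY φ hφ ⟨σ, hσ⟩
  obtain ⟨K, hK⟩ := he.exists_norm_sum_act_le mY σ
  obtain ⟨ψ, hψ⟩ : ∃ ψ : I →L[ℂ] Y, ∀ f : I,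
      HasSum (fun i => mY.act ((f : A) * e i) (σ (e i))) (ψ f) :=
    exists_clm_hasSum_of_norm_sum_le
      (fun i => (mY.act.flip (σ (e i))).comp
        (((ContinuousLinearMap.mul ℂ A).flip (e i : A)).comp I.subtypeL))
      K (fun f => he.summable_act mY σ f.2) fun t f => hK t f
  refine ⟨ψ, fun a f => ?_, ?_⟩
  · have h : HasSum (fun i => mY.act (a * (f : A) * e i) (σ (e i))) (mY.act a (ψ f)) := by
      simpa only [mul_assoc, mY.mul_act] using (mY.act a).hasSum (hψ f)
    exact (hψ _).unique h
  · ext f : 1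
    have hterm : ∀ i, (φ (mY.act ((f : A) * e i) (σ (e i))) : A) = f * e i := fun i => by
      rw [hφ, ← ContinuousLinearMap.comp_apply φ σ, hσ]
      exact (mul_assoc _ _ _).trans (congrArg _ (he.isIdempotentElem i))
    have hφψ : HasSum (fun i => (f : A) * e i) (φ (ψ f) : A) := by
      simpa only [ContinuousLinearMap.comp_apply, Submodule.subtypeL_apply, hterm]
        using (I.subtypeL.comp φ).hasSum (hψ f)
    exact Subtype.ext (hφψ.unique (he.hasSum_mul f f.2))

end IsOrthogonalApproxUnit

end ApproxUnit

/-! ### Characteristic functions of clopen sets -/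

section ClopenIndicator

variable {X R : Type*} [TopologicalSpace X]

section TopologicalSpace

variable [TopologicalSpace R]

variable (R) in
/-- The characteristic function of a clopen set, as an element of the algebra `C(X, R)`. -/
noncomputable def clopenIndicator [MulZeroOneClass R] {s : Set X} (hs : IsClopen s) : C(X, R) :=
  LocallyConstant.charFn R hs

@[simp]
theorem clopenIndicator_apply [MulZeroOneClass R] {s : Set X} (hs : IsClopen s) (x : X) :
    clopenIndicator R hs x = s.indicator 1 x :=
  rfl

theorem clopenIndicator_mul_clopenIndicator [MulZeroOneClass R] [ContinuousMul R] {s t : Set X}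
    (hs : IsClopen s) (ht : IsClopen t) :
    clopenIndicator R hs * clopenIndicator R ht = clopenIndicator R (hs.inter ht) := by
  ext x
  simp [Set.inter_indicator_one]

theorem sum_clopenIndicator_apply [NonAssocSemiring R] {ι : Type*} {S : ι → Set X}
    (hS : ∀ i, IsClopen (S i)) (hd : Pairwise (Function.onFun Disjoint S)) (t : Finset ι) (x : X) :
    ∑ i ∈ t, clopenIndicator R (hS i) x = (⋃ i ∈ t, S i).indicator 1 x := by
  rw [Finset.indicator_biUnion t S fun i _ j _ hij => hd hij]
  rfl

end TopologicalSpace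

variable [CompactSpace X] [NormedRing R]

theorem one_le_dist_clopenIndicator [NormOneClass R] {s t : Set X} (hs : IsClopen s)
    (ht : IsClopen t) (hst : s ≠ t) :
    1 ≤ dist (clopenIndicator R hs) (clopenIndicator R ht) := by
  obtain ⟨x, hx⟩ := Set.symmDiff_nonempty.2 hst
  refine le_trans ?_ (ContinuousMap.dist_apply_le_dist x)
  rcases hx with ⟨hxs, hxt⟩ | ⟨hxt, hxs⟩ <;> simp [hxs, hxt, dist_eq_norm]

theorem countable_clopens_of_separableSpace [NormOneClass R] [SeparableSpace C(X, R)] :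
    Countable (Clopens X) := by
  let χ : Clopens X → C(X, R) := fun s => clopenIndicator R s.isClopen
  have hχ : ∀ s t, s ≠ t → 1 ≤ dist (χ s) (χ t) := fun s t hst =>
    one_le_dist_clopenIndicator _ _ (SetLike.coe_injective.ne hst)
  have hdisj : Set.univ.PairwiseDisjoint fun s => Metric.ball (χ s) (1 / 2) :=
    fun s _ t _ hst => Metric.ball_disjoint_ball (by linarith [hχ s t hst])
  exact Set.countable_univ_iff.1 <| hdisj.countable_of_isOpen (fun _ _ => Metric.isOpen_ball)
    fun s _ => ⟨χ s, Metric.mem_ball_self one_half_pos⟩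

variable {ι : Type*} {S : ι → Set X} (hS : ∀ i, IsClopen (S i))
  (hd : Pairwise (Function.onFun Disjoint S))

include hd

theorem norm_sum_sign_smul_clopenIndicator_le [NormOneClass R] (t : Finset ι) (ε : t → ℤˣ) :
    ‖∑ i : t, ε i • clopenIndicator R (hS i)‖ ≤ 1 := by
  refine (ContinuousMap.norm_le _ zero_le_one).2 fun x => ?_
  calc ‖(∑ i : t, ε i • clopenIndicator R (hS i)) x‖
      ≤ ∑ i : t, ‖clopenIndicator R (hS i) x‖ := by
        rw [ContinuousMap.sum_apply]
        refine norm_sum_le_of_le _ fun i _ => ?_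
        rw [Units.smul_def, ContinuousMap.smul_apply, ← Units.smul_def, norm_units_zsmul]
    _ = ∑ i ∈ t, clopenIndicator ℝ (hS i) x := by
        rw [← Finset.sum_coe_sort t]
        simp [norm_indicator_eq_indicator_norm, Pi.one_def]
    _ = (⋃ i ∈ t, S i).indicator 1 x := sum_clopenIndicator_apply hS hd t x
    _ ≤ 1 := Set.indicator_le_self' (fun _ _ => zero_le_one) x

theorem hasSum_mul_clopenIndicator {f : C(X, R)} (hf : ∀ x ∉ ⋃ i, S i, f x = 0) :
    HasSum (fun i => f * clopenIndicator R (hS i)) f := by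
  rw [HasSum, SummationFilter.unconditional_filter, Metric.tendsto_nhds]
  intro δ hδ
  have hK : IsCompact {x | δ ≤ ‖f x‖} := (isClosed_le (by fun_prop) (by fun_prop)).isCompact
  obtain ⟨t, ht⟩ := hK.elim_finite_subcover S (fun i => (hS i).isOpen) fun x hx => by
    by_contra hxS
    exact (hδ.trans_le hx).ne' (norm_eq_zero.2 (hf x hxS))
  filter_upwards [eventually_ge_atTop t] with s hts
  refine (ContinuousMap.dist_lt_iff hδ).2 fun x => ?_
  have hsum : (∑ i ∈ s, f * clopenIndicator R (hS i)) x =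
      f x * (⋃ i ∈ s, S i).indicator 1 x := by
    rw [← sum_clopenIndicator_apply hS hd, ContinuousMap.sum_apply, Finset.mul_sum]
    rfl
  rw [hsum]
  by_cases hx : x ∈ ⋃ i ∈ s, S i
  · simpa [hx] using hδ
  · have hfx : ‖f x‖ < δ := not_le.1 fun h => hx (Set.biUnion_mono hts (fun _ _ => le_rfl) (ht h))
    simpa [hx, dist_eq_norm] using hfx

end ClopenIndicator

/-! ### Hereditary projectivity of algebras of continuous functions -/

section HereditarilyProjective

variable {X : Type u} [TopologicalSpace X] [CompactSpace X]

theorem isProjective_ofLeftIdeal_of_disjoint_isClopen {ι : Type*} {I : Submodule ℂ C(X, ℂ)}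
    (hI : IsLeftIdeal I) {S : ι → Set X} (hS : ∀ i, IsClopen (S i))
    (hd : Pairwise (Function.onFun Disjoint S))
    (hIS : ∀ f, f ∈ I ↔ ∀ x ∉ ⋃ i, S i, f x = 0) :
    LeftBanachModule.IsProjective.{u, u, w} (LeftBanachModule.ofLeftIdeal I hI) := by
  have hmem : ∀ i, clopenIndicator ℂ (hS i) ∈ I := fun i => (hIS _).2 fun x hx =>
    Set.indicator_of_notMem (fun hxi => hx (Set.mem_iUnion_of_mem i hxi)) _
  have he : IsOrthogonalApproxUnit I fun i => (⟨clopenIndicator ℂ (hS i), hmem i⟩ : I) :=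
    { isIdempotentElem := fun i => by
        simp only [IsIdempotentElem, clopenIndicator_mul_clopenIndicator, Set.inter_self]
      mul_eq_zero := fun i j hij => by
        simp only [clopenIndicator_mul_clopenIndicator, (hd hij).inter_eq]
        ext x
        simp
      exists_norm_le := ⟨1, fun t ε => by
        have hcoe : ((∑ i : t, ε i • (⟨clopenIndicator ℂ (hS i), hmem i⟩ : I) : I) : C(X, ℂ)) =
            ∑ i : t, ε i • clopenIndicator ℂ (hS i) := map_sum I.subtype _ _
        rw [Submodule.coe_norm, hcoe]
        exact norm_sum_sign_smul_clopenIndicator_le hS hd t ε⟩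
      hasSum_mul := fun f hf => hasSum_mul_clopenIndicator hS hd ((hIS f).1 hf) }
  exact he.isProjective_ofLeftIdeal hI

variable [T2Space X]

theorem exists_isOpen_forall_mem_iff_of_isClosed {I : Submodule ℂ C(X, ℂ)} (hI : IsLeftIdeal I)
    (hc : IsClosed (I : Set C(X, ℂ))) :
    ∃ U : Set X, IsOpen U ∧ ∀ f, f ∈ I ↔ ∀ x ∉ U, f x = 0 := by
  let J : Ideal C(X, ℂ) := { I with smul_mem' := hI }
  refine ⟨ContinuousMap.setOfIdeal J, ContinuousMap.setOfIdeal_open J, fun f => ?_⟩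
  change f ∈ J ↔ _
  conv_lhs => rw [← ContinuousMap.idealOfSet_ofIdeal_isClosed (I := J) hc]
  exact ContinuousMap.mem_idealOfSet

theorem exists_disjoint_isClopen_iUnion_eq [TotallyDisconnectedSpace X]
    [HereditarilyLindelofSpace X] {U : Set X} (hU : IsOpen U) :
    ∃ S : ℕ → Set X, (∀ n, IsClopen (S n)) ∧ Pairwise (Function.onFun Disjoint S) ∧
      ⋃ n, S n = U := by
  choose! V hV hxV hVU using fun x (hx : x ∈ U) => compact_exists_isClopen_in_isOpen hU hx
  obtain ⟨T, hTc, hTU, hUT⟩ := (HereditarilyLindelofSpace.isLindelof U).elim_nhds_subcover V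
    fun x hx => (hV x hx).isOpen.mem_nhds (hxV x hx)
  obtain ⟨s, hs⟩ := ((hTc.image V).insert ∅).exists_eq_range (Set.insert_nonempty _ _)
  have hclopen : ∀ n, IsClopen (s n) := by
    rw [← Set.forall_mem_range (p := IsClopen), ← hs]
    simpa [isClopen_empty] using fun x hx => hV x (hTU x hx)
  refine ⟨disjointed s, fun n => disjointedRec (fun _ i ht => ht.diff (hclopen i)) (hclopen n),
    disjoint_disjointed s, ?_⟩
  calc ⋃ n, disjointed s n = ⋃₀ Set.range s := by rw [iUnion_disjointed, Set.sUnion_range]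
    _ = ⋃ x ∈ T, V x := by rw [← hs, Set.sUnion_insert, Set.sUnion_image, Set.empty_union]
    _ = U := (Set.iUnion₂_subset fun x hx => hVU x (hTU x hx)).antisymm hUT

theorem isHereditarilyProjective_continuousMap [TotallyDisconnectedSpace X]
    [HereditarilyLindelofSpace X] : IsHereditarilyProjective.{u, w} C(X, ℂ) := by
  intro I hI hc
  obtain ⟨U, hU, hIU⟩ := exists_isOpen_forall_mem_iff_of_isClosed hI hc
  obtain ⟨S, hS, hd, rfl⟩ := exists_disjoint_isClopen_iUnion_eq hU
  exact isProjective_ofLeftIdeal_of_disjoint_isClopen hI hS hd hIU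

end HereditarilyProjective

/-! ### Diagonal operators -/

theorem separableSpace_of_hilbertBasis {ι 𝕜 E : Type*} [Countable ι] [RCLike 𝕜]
    [NormedAddCommGroup E] [InnerProductSpace 𝕜 E] (b : HilbertBasis ι 𝕜 E) : SeparableSpace E := by
  have h := (Set.countable_range b).isSeparable.span (R := 𝕜) |>.closure
  rw [← Submodule.topologicalClosure_coe, b.dense_span] at h
  exact isSeparable_univ_iff.1 h

section Diagonal

variable {𝕜 X ι : Type*} [RCLike 𝕜] [TopologicalSpace X] [CompactSpace X]

/-- The representation of `C(X, 𝕜)` on `ℓ²(ι)` by diagonal operators: `f` acts as multiplication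
by its values along the family of points `d`. -/
noncomputable def diagonalStarAlgHom (d : ι → X) :
    C(X, 𝕜) →⋆ₐ[𝕜] (lp (fun _ : ι => 𝕜) 2 →L[𝕜] lp (fun _ : ι => 𝕜) 2) where
  toFun f := lp.mapCLM 2 (fun i => ContinuousLinearMap.mul 𝕜 𝕜 (f (d i))) (norm_nonneg f)
    fun i => (ContinuousLinearMap.opNorm_mul_apply_le 𝕜 𝕜 _).trans (f.norm_coe_le_norm _)
  map_one' := by ext v i; simp
  map_mul' f g := by ext v i; simp [mul_assoc]
  map_zero' := by ext v i; simp
  map_add' f g := by ext v i; simp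
  commutes' c := by ext v i; simp [Algebra.algebraMap_eq_smul_one]
  map_star' f := by
    rw [ContinuousLinearMap.star_eq_adjoint, ContinuousLinearMap.eq_adjoint_iff]
    intro v w
    simp only [lp.inner_eq_tsum]
    refine tsum_congr fun i => ?_
    simp [mul_left_comm, mul_comm]

@[simp]
theorem diagonalStarAlgHom_apply_apply (d : ι → X) (f : C(X, 𝕜)) (v : lp (fun _ : ι => 𝕜) 2)
    (i : ι) : diagonalStarAlgHom d f v i = f (d i) * v i :=
  rfl

theorem diagonalStarAlgHom_injective {d : ι → X} (hd : DenseRange d) :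
    Function.Injective (diagonalStarAlgHom (𝕜 := 𝕜) d) := by
  classical
  intro f g hfg
  refine DFunLike.coe_injective (hd.equalizer f.continuous g.continuous (funext fun i => ?_))
  simpa using congrArg (fun φ => φ (lp.single 2 i 1) i) hfg

end Diagonal

theorem exists_isometry_separable_hilbertSpace (X : Type u) [TopologicalSpace X] [CompactSpace X]
    [SeparableSpace X] :
    ∃ (H : Type u) (_ : NormedAddCommGroup H) (_ : InnerProductSpace ℂ H) (_ : CompleteSpace H)
      (_ : SeparableSpace H) (φ : C(X, ℂ) →⋆ₐ[ℂ] (H →L[ℂ] H)), Isometry φ := by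
  obtain ⟨D, hDc, hD⟩ := exists_countable_dense X
  have := hDc.to_subtype
  exact ⟨lp (fun _ : D => ℂ) 2, inferInstance, inferInstance, inferInstance,
    separableSpace_of_hilbertBasis ⟨LinearIsometryEquiv.refl ℂ _⟩,
    diagonalStarAlgHom ((↑) : D → X),
    NonUnitalStarAlgHom.isometry _ (diagonalStarAlgHom_injective hD.denseRange_val)⟩

/-! ### Topology of the two arrows space -/

section Coinitial

variable {α : Type*} [LinearOrder α] [TopologicalSpace α] [OrderTopology α]
  [SecondCountableTopology α]

theorem exists_countable_coinitial_subset (S : Set α) :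
    ∃ T ⊆ S, T.Countable ∧ ∀ x ∈ S, ∃ t ∈ T, t ≤ x := by
  obtain ⟨T, hTS, hTc, hT⟩ := isOpen_biUnion_countable S Set.Ioi fun _ _ => isOpen_Ioi
  -- An element of `S` outside the rays `Set.Ioi t`, `t ∈ T`, is a least element of `S`.
  refine ⟨T ∪ {m | IsLeast S m}, Set.union_subset hTS fun m hm => hm.1, hTc.union ?_,
    fun x hx => ?_⟩
  · exact Set.Subsingleton.countable fun a ha b hb => ha.unique hb
  · by_cases hleast : IsLeast S x
    · exact ⟨x, Or.inr hleast, le_rfl⟩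
    · obtain ⟨y, hy, hyx⟩ : ∃ y ∈ S, y < x := by
        simpa [IsLeast, lowerBounds, hx] using hleast
      have hxT : x ∈ ⋃ t ∈ T, Set.Ioi t := hT ▸ Set.mem_biUnion hy hyx
      obtain ⟨t, ht, htx⟩ := Set.mem_iUnion₂.1 hxT
      exact ⟨t, Or.inl ht, le_of_lt htx⟩

theorem exists_countable_cofinal_subset (S : Set α) :
    ∃ T ⊆ S, T.Countable ∧ ∀ x ∈ S, ∃ t ∈ T, x ≤ t :=
  exists_countable_coinitial_subset (α := αᵒᵈ) S

end Coinitial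

namespace TwoArrows

/-- The set `[α, β) ∪ (α', β']`, with `[α, β)` in the lower and `(α', β']` in the upper
interval. These sets are clopen and form a base of the topology. -/
def clopenArrow (α β : ℝ) : Set TwoArrows :=
  lowerArrow α β ∪ upperArrow α β

@[simp]
theorem lower_mem_clopenArrow {α β : ℝ} {x : Set.Ico (0 : ℝ) 1} :
    lower x ∈ clopenArrow α β ↔ α ≤ x.1 ∧ x.1 < β := by
  simp only [clopenArrow, Set.mem_union, lower_mem_lowerArrow, lower_mem_upperArrow]
  grind

@[simp]
theorem upper_mem_clopenArrow {α β : ℝ} {x : Set.Ioc (0 : ℝ) 1} :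
    upper x ∈ clopenArrow α β ↔ α < x.1 ∧ x.1 ≤ β := by
  simp only [clopenArrow, Set.mem_union, upper_mem_lowerArrow, upper_mem_upperArrow]
  grind

theorem isOpen_clopenArrow (α β : ℝ) : IsOpen (clopenArrow α β) := by
  have hclamp : clopenArrow α β = clopenArrow (max α 0) (min β 1) := by
    ext (⟨x, hx⟩ | ⟨x, hx⟩) <;> simp only [lower_mem_clopenArrow, upper_mem_clopenArrow] <;> grind
  rw [hclamp]
  rcases lt_or_ge (max α 0) (min β 1) with hlt | hge
  · have hbase : lowerArrow (max α 0) (min β 1) ∈ base ∧ upperArrow (max α 0) (min β 1) ∈ base :=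
      ⟨⟨_, _, le_max_right _ _, hlt, min_le_right _ _, Or.inl rfl⟩,
        ⟨_, _, le_max_right _ _, hlt, min_le_right _ _, Or.inr rfl⟩⟩
    exact (isTopologicalBasis_base.isOpen hbase.1).union (isTopologicalBasis_base.isOpen hbase.2)
  · simp [clopenArrow, lowerArrow, upperArrow, hge]

theorem compl_clopenArrow (α β : ℝ) :
    (clopenArrow α β)ᶜ = clopenArrow 0 α ∪ clopenArrow β 1 := by
  ext (⟨x, hx⟩ | ⟨x, hx⟩) <;>
    simp only [Set.mem_compl_iff, Set.mem_union, lower_mem_clopenArrow, upper_mem_clopenArrow] <;>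
    grind

theorem isClopen_clopenArrow (α β : ℝ) : IsClopen (clopenArrow α β) := by
  refine ⟨⟨?_⟩, isOpen_clopenArrow α β⟩
  rw [compl_clopenArrow]
  exact (isOpen_clopenArrow 0 α).union (isOpen_clopenArrow β 1)

instance : TotallySeparatedSpace TwoArrows := by
  refine totallySeparatedSpace_iff_exists_isClopen.2 fun p q hpq => ?_
  suffices h : ∃ α β, p ∈ clopenArrow α β ∧ q ∉ clopenArrow α β by
    obtain ⟨α, β, hp, hq⟩ := h
    exact ⟨_, isClopen_clopenArrow α β, hp, hq⟩
  rcases p with ⟨x, hx⟩ | ⟨x, hx⟩ <;> rcases q with ⟨y, hy⟩ | ⟨y, hy⟩ <;>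
    simp only [lower_mem_clopenArrow, upper_mem_clopenArrow]
  · obtain hxy | hyx := lt_or_gt_of_ne (show x ≠ y by rintro rfl; exact hpq rfl)
    · exact ⟨0, y, by grind⟩
    · exact ⟨x, 1, by grind⟩
  · obtain hxy | hyx := lt_or_ge x y
    · exact ⟨0, (x + y) / 2, by grind⟩
    · exact ⟨x, 1, by grind⟩
  · obtain hxy | hyx := le_or_gt x y
    · exact ⟨0, x, by grind⟩
    · exact ⟨(x + y) / 2, 1, by grind⟩
  · obtain hxy | hyx := lt_or_gt_of_ne (show x ≠ y by rintro rfl; exact hpq rfl)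
    · exact ⟨0, x, by grind⟩
    · exact ⟨y, 1, by grind⟩

instance : SeparableSpace TwoArrows := by
  refine ⟨lower '' {x | ∃ q : ℚ, (q : ℝ) = x.1},
    ((Set.countable_range ((↑) : ℚ → ℝ)).preimage Subtype.val_injective).image _,
    isTopologicalBasis_base.dense_iff.2 ?_⟩
  rintro s ⟨a, b, ha, hab, hb, hs⟩ -
  obtain ⟨q, haq, hqb⟩ := exists_rat_btwn hab
  refine ⟨lower ⟨q, ha.trans haq.le, hqb.trans_le hb⟩, ?_, _, ⟨q, rfl⟩, rfl⟩
  rcases hs with rfl | rfl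
  · exact lower_mem_lowerArrow.2 ⟨haq.le, hqb⟩
  · exact lower_mem_upperArrow.2 ⟨haq, hqb⟩

theorem exists_rat_clopenArrow_subset_of_lower_mem {U : Set TwoArrows} (hU : IsOpen U)
    {x : Set.Ico (0 : ℝ) 1} (hx : lower x ∈ U) : ∃ q : ℚ, x.1 < q ∧ clopenArrow x q ⊆ U := by
  obtain ⟨s, ⟨a, b, -, -, -, hs⟩, hxs, hsU⟩ := isTopologicalBasis_base.isOpen_iff.1 hU _ hx
  have hxab : a ≤ x.1 ∧ x.1 < b := by
    rcases hs with rfl | rfl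
    · exact lower_mem_lowerArrow.1 hxs
    · exact (lower_mem_upperArrow.1 hxs).imp_left le_of_lt
  obtain ⟨q, hxq, hqb⟩ := exists_rat_btwn hxab.2
  refine ⟨q, hxq, Set.Subset.trans ?_ hsU⟩
  rintro (y | y) hy <;> rcases hs with rfl | rfl <;>
    simp only [lower_mem_lowerArrow, lower_mem_upperArrow, upper_mem_lowerArrow,
      upper_mem_upperArrow, lower_mem_clopenArrow, upper_mem_clopenArrow] at hxs hy ⊢ <;> grind

theorem exists_rat_clopenArrow_subset_of_upper_mem {U : Set TwoArrows} (hU : IsOpen U)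
    {x : Set.Ioc (0 : ℝ) 1} (hx : upper x ∈ U) : ∃ q : ℚ, q < x.1 ∧ clopenArrow q x ⊆ U := by
  obtain ⟨s, ⟨a, b, -, -, -, hs⟩, hxs, hsU⟩ := isTopologicalBasis_base.isOpen_iff.1 hU _ hx
  have hxab : a < x.1 ∧ x.1 ≤ b := by
    rcases hs with rfl | rfl
    · exact (upper_mem_lowerArrow.1 hxs).imp_right le_of_lt
    · exact upper_mem_upperArrow.1 hxs
  obtain ⟨q, haq, hqx⟩ := exists_rat_btwn hxab.1
  refine ⟨q, hqx, Set.Subset.trans ?_ hsU⟩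
  rintro (y | y) hy <;> rcases hs with rfl | rfl <;>
    simp only [lower_mem_lowerArrow, lower_mem_upperArrow, upper_mem_lowerArrow,
      upper_mem_upperArrow, lower_mem_clopenArrow, upper_mem_clopenArrow] at hxs hy ⊢ <;> grind

theorem isLindelof_of_isOpen {U : Set TwoArrows} (hU : IsOpen U) : IsLindelof U := by
  choose T hTU hTc hT using fun q : ℚ =>
    exists_countable_coinitial_subset {a : ℝ | clopenArrow a q ⊆ U}
  choose T' hTU' hTc' hT' using fun q : ℚ =>
    exists_countable_cofinal_subset {b : ℝ | clopenArrow q b ⊆ U}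
  have hU_eq : U = (⋃ q : ℚ, ⋃ a ∈ T q, clopenArrow a q) ∪
      ⋃ q : ℚ, ⋃ b ∈ T' q, clopenArrow q b := by
    refine Set.Subset.antisymm ?_ (Set.union_subset (Set.iUnion_subset fun q =>
      Set.iUnion₂_subset (hTU q)) (Set.iUnion_subset fun q => Set.iUnion₂_subset (hTU' q)))
    rintro (x | x) hx
    · obtain ⟨q, hxq, hq⟩ := exists_rat_clopenArrow_subset_of_lower_mem hU hx
      obtain ⟨a, ha, hax⟩ := hT q x hq
      exact Or.inl (Set.mem_iUnion_of_mem q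
        (Set.mem_biUnion ha (lower_mem_clopenArrow.2 ⟨hax, hxq⟩)))
    · obtain ⟨q, hqx, hq⟩ := exists_rat_clopenArrow_subset_of_upper_mem hU hx
      obtain ⟨b, hb, hxb⟩ := hT' q x hq
      exact Or.inr (Set.mem_iUnion_of_mem q
        (Set.mem_biUnion hb (upper_mem_clopenArrow.2 ⟨hqx, hxb⟩)))
  have hLind : ∀ α β, IsLindelof (clopenArrow α β) := fun α β =>
    (isClopen_clopenArrow α β).isClosed.isLindelof
  rw [hU_eq]
  exact (isLindelof_iUnion fun q => (hTc q).isLindelof_biUnion fun a _ => hLind a q).union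
    (isLindelof_iUnion fun q => (hTc' q).isLindelof_biUnion fun b _ => hLind q b)

instance : HereditarilyLindelofSpace TwoArrows :=
  .of_forall_isOpen fun _ => isLindelof_of_isOpen

instance : Uncountable (Clopens TwoArrows) := by
  have : Uncountable (Set.Ico (0 : ℝ) 1) := not_countable_iff.1 fun h =>
    (Cardinal.Real.Ico_countable_iff.1 h).not_gt one_pos
  let segment : Set.Ico (0 : ℝ) 1 → Clopens TwoArrows := fun t => ⟨_, isClopen_clopenArrow 0 t⟩
  have hsegment : ∀ s t, lower s ∈ segment t ↔ s < t := fun s t =>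
    lower_mem_clopenArrow.trans (and_iff_right s.2.1)
  have hinj : Function.Injective segment := fun s t hst =>
    eq_of_forall_lt_iff fun r => by rw [← hsegment, ← hsegment, hst]
  exact hinj.uncountable

theorem not_separableSpace_continuousMap : ¬ SeparableSpace C(TwoArrows, ℂ) := fun _ =>
  not_countable (countable_clopens_of_separableSpace (R := ℂ) (X := TwoArrows))

end TwoArrows

theorem mainTheorem12 :
    ¬ TopologicalSpace.SeparableSpace C(TwoArrows, ℂ) ∧
    IsHereditarilyProjective.{0, w} C(TwoArrows, ℂ) ∧
    ∃ (H : Type) (_ : NormedAddCommGroup H) (_ : InnerProductSpace ℂ H) (_ : CompleteSpace H)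
      (_ : TopologicalSpace.SeparableSpace H) (φ : C(TwoArrows, ℂ) →⋆ₐ[ℂ] (H →L[ℂ] H)),
      Isometry φ :=
  ⟨TwoArrows.not_separableSpace_continuousMap, isHereditarilyProjective_continuousMap,
    exists_isometry_separable_hilbertSpace TwoArrows⟩
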